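/- Let $G$ be a real Lie group with a $C^\infty$ action on a (Hausdorff, not necessarily connected) $C^\infty$ manifold $M$ of dimension $d$. Assume that the action is proper, i.e. the map $G\times M\to M\times M$, $(g,x)\mapsto(gx,x)$, is proper, and that it is component effective, i.e. for every $g\in G\setminus\{1_G\}$ and every connected component $M^\circ$ of $M$ there is $x\in M^\circ$ with $gx\neq x$. For $\ell\geq 1$ let $\mathcal F^\ell M$ be the $\ell$-th order frame bundle of $M$, i.e. the space of $\ell$-jets $j^\ell_0\varphi$ at $0$ of local diffeomorphisms $\varphi$ from a neighbourhood of $0$ in $\mathbb R^d$ into $M$, with its usual manifold topology, and let $G$ act on $\mathcal F^\ell M$ by prolongation, $g\cdot j^\ell_0\varphi=j^\ell_0(g\circ\varphi)$, where $g$ also denotes the diffeomorphism $x\mapsto gx$ of $M$. Then, for every integer $\ell\geq 1$, the $G$-action on $\mathcal F^\ell M$ is proper and free (every stabilizer is trivial). -/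

import Mathlib

open scoped Manifold ContDiff Topology

noncomputable section

/-- The action of `G` on `X` is component effective: no nontrivial element of `G` fixes a whole
connected component of `X` pointwise. -/
def ComponentEffective (G X : Type*) [Group G] [MulAction G X] [TopologicalSpace X] : Prop :=
  ∀ g : G, g ≠ 1 → ∀ p : X, ∃ x ∈ connectedComponent p, g • x ≠ x

/-- The action of `G` on `X` is free: every stabilizer is trivial. -/
def FreeAction (G X : Type*) [Group G] [MulAction G X] : Prop :=
  ∀ x : X, MulAction.stabilizer G x = ⊥

section FrameBundle

variable (d : ℕ) (ℓ : ℕ) (M : Type*) [TopologicalSpace M]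
  [ChartedSpace (EuclideanSpace ℝ (Fin d)) M]

/-- Parametrizations of `M` around a point: maps `ℝᵈ → M` which restrict to a smooth diffeomorphism
from an open neighbourhood of `0` onto an open subset of `M`. Only the germ at `0` will matter. -/
def LocalParam : Type _ :=
  {φ : EuclideanSpace ℝ (Fin d) → M // IsLocalDiffeomorphAt (𝓡 d) (𝓡 d) ∞ φ 0}

/-- The space of `ℓ`-jets at `0` of maps `ℝᵈ → ℝᵈ`, as tuples of derivatives of order `0, …, ℓ`. -/
abbrev JetSpace : Type :=
  (k : Fin (ℓ + 1)) → ContinuousMultilinearMap ℝ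
    (fun _ : Fin (k : ℕ) => EuclideanSpace ℝ (Fin d)) (EuclideanSpace ℝ (Fin d))

variable {d M}

/-- The Taylor coefficients up to order `ℓ` at `0` of the map `φ : ℝᵈ → M` read in the chart `c`.
Meaningful when `φ 0` lies in the domain of `c`. -/
def jetInChart (c : OpenPartialHomeomorph M (EuclideanSpace ℝ (Fin d)))
    (φ : EuclideanSpace ℝ (Fin d) → M) : JetSpace d ℓ :=
  fun k => iteratedFDeriv ℝ (k : ℕ) (fun v => c (φ v)) 0

variable (d M)

/-- Two parametrizations have the same `ℓ`-jet at `0` if they have the same value at `0` and, in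
every smooth chart around that value, the same derivatives at `0` up to order `ℓ`. -/
def jetSetoid : Setoid (LocalParam d M) where
  r φ ψ := φ.1 0 = ψ.1 0 ∧ ∀ c ∈ IsManifold.maximalAtlas (𝓡 d) ∞ M, φ.1 0 ∈ c.source →
    jetInChart ℓ c φ.1 = jetInChart ℓ c ψ.1
  iseqv :=
    { refl := fun _ => ⟨rfl, fun _ _ _ => rfl⟩
      symm := fun h => ⟨h.1.symm, fun c hc hx => (h.2 c hc (h.1 ▸ hx)).symm⟩
      trans := fun h h' => ⟨h.1.trans h'.1, fun c hc hx =>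
        (h.2 c hc hx).trans (h'.2 c hc (h.1 ▸ hx))⟩ }

/-- The `ℓ`-th order frame bundle of a `d`-dimensional manifold `M`: the set of `ℓ`-jets at `0` of
local diffeomorphisms from `ℝᵈ` to `M`. -/
def FrameBundle : Type _ := Quotient (jetSetoid d ℓ M)

variable {d M}

/-- The frame (`ℓ`-jet at `0`) of a parametrization. -/
def FrameBundle.mk (φ : LocalParam d M) : FrameBundle d ℓ M := Quotient.mk (jetSetoid d ℓ M) φ

/-- The frames over the domain of the chart `c` whose coordinates in `c` lie in `V`. -/
def FrameBundle.box (c : OpenPartialHomeomorph M (EuclideanSpace ℝ (Fin d)))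
    (V : Set (JetSpace d ℓ)) : Set (FrameBundle d ℓ M) :=
  {u | ∃ φ : LocalParam d M, FrameBundle.mk ℓ φ = u ∧ φ.1 0 ∈ c.source ∧ jetInChart ℓ c φ.1 ∈ V}

/-- The manifold topology of the frame bundle: the smooth charts `c` of `M` induce the coordinates
`jetInChart ℓ c` on the frames over the domain of `c`, and the topology is the one generated by
the preimages of open sets under all these coordinates. -/
instance FrameBundle.instTopologicalSpace : TopologicalSpace (FrameBundle d ℓ M) :=
  TopologicalSpace.generateFrom
    {S | ∃ c ∈ IsManifold.maximalAtlas (𝓡 d) ∞ M, ∃ V : Set (JetSpace d ℓ),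
      IsOpen V ∧ S = FrameBundle.box ℓ c V}

end FrameBundle

section Prolongation

variable {m d : ℕ} (ℓ : ℕ) {G : Type*} [Group G] [TopologicalSpace G]
  [ChartedSpace (EuclideanSpace ℝ (Fin m)) G]
  {M : Type*} [TopologicalSpace M] [ChartedSpace (EuclideanSpace ℝ (Fin d)) M]
  [MulAction G M]

/-- The composition of a parametrization with the translation by `g`. -/
def LocalParam.translate (hsm : ContMDiffSMul (𝓡 m) (𝓡 d) ∞ G M) (g : G)
    (φ : LocalParam d M) : LocalParam d M :=
  ⟨fun v => g • φ.1 v,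
    φ.2.comp (K := 𝓡 d)
      (hg := (Diffeomorph.smul (𝓡 m) (𝓡 d) ∞ g).isLocalDiffeomorph (φ.1 0))⟩

/-- The pullback of a smooth chart by a translation is a smooth chart. -/
theorem smul_chart_mem_maximalAtlas [IsManifold (𝓡 d) ∞ M]
    (hsm : ContMDiffSMul (𝓡 m) (𝓡 d) ∞ G M) (g : G)
    {c : OpenPartialHomeomorph M (EuclideanSpace ℝ (Fin d))}
    (hc : c ∈ IsManifold.maximalAtlas (𝓡 d) ∞ M) :
    (Diffeomorph.smul (M := M) (𝓡 m) (𝓡 d) ∞ g).toHomeomorph.transOpenPartialHomeomorph c ∈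
      IsManifold.maximalAtlas (𝓡 d) ∞ M := by
  apply OpenPartialHomeomorph.mem_maximalAtlas_of_contMDiffOn
  · exact (contMDiffOn_of_mem_maximalAtlas hc).comp
      (Diffeomorph.smul (𝓡 m) (𝓡 d) ∞ g).contMDiff.contMDiffOn (fun x hx => hx)
  · exact (Diffeomorph.smul (M := M) (𝓡 m) (𝓡 d) ∞ g).symm.contMDiff.comp_contMDiffOn
      (contMDiffOn_symm_of_mem_maximalAtlas hc)

theorem jetSetoid_translate [IsManifold (𝓡 d) ∞ M]
    (hsm : ContMDiffSMul (𝓡 m) (𝓡 d) ∞ G M) (g : G) (φ ψ : LocalParam d M)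
    (h : (jetSetoid d ℓ M).r φ ψ) :
    (jetSetoid d ℓ M).r (φ.translate hsm g) (ψ.translate hsm g) :=
  ⟨congrArg (g • ·) h.1, fun _ hc hx =>
    h.2 _ (smul_chart_mem_maximalAtlas hsm g hc) hx⟩

/-- The prolongation to the `ℓ`-th order frame bundle of a smooth action of `G` on `M`: the element
`g` sends the `ℓ`-jet of `φ` to the `ℓ`-jet of `v ↦ g • φ v`. -/
@[reducible] def prolongedAction [IsManifold (𝓡 d) ∞ M]
    (hsm : ContMDiffSMul (𝓡 m) (𝓡 d) ∞ G M) : MulAction G (FrameBundle d ℓ M) where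
  smul g u := Quotient.map (LocalParam.translate hsm g)
    (fun φ ψ h => jetSetoid_translate ℓ hsm g φ ψ h) u
  one_smul u := by
    refine Quotient.inductionOn u fun φ => ?_
    have h : LocalParam.translate hsm 1 φ = φ := Subtype.ext (funext fun v => one_smul G (φ.1 v))
    exact congrArg (FrameBundle.mk ℓ) h
  mul_smul g g' u := by
    refine Quotient.inductionOn u fun φ => ?_
    have h : φ.translate hsm (g * g') = (φ.translate hsm g').translate hsm g :=
      Subtype.ext (funext fun v => mul_smul g g' (φ.1 v))
    exact congrArg (FrameBundle.mk ℓ) h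

end Prolongation

end

/-! Freeness. If `g` fixes the `ℓ`-jet of `φ` and `ℓ ≥ 1`, then `g` fixes `x = φ 0`, and cancelling
the invertible differential of `φ` shows that the differential of `g` at `x` is the identity.
Properness makes the stabilizer of `x` compact, so in a chart some ball around `x` works for all its
elements at once: on this ball their derivatives vary by at most `1/2`. Every power `g ^ n` has
identity differential at `x`, hence `g ^ n - id` is `1/2`-Lipschitz on the ball. For `v` near `x`,
the increments of the orbit `g ^ n v` therefore stay within `‖w‖ / 2` of `w = g v - v`; the orbit is
bounded, so `w = 0` (`eq_zero_of_norm_increment_sub_le`). Thus `g` is trivial near `x`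
(`eventually_smul_eq_of_hasFDerivAt_id`). The points near which `g` is trivial form a clopen set, so
`g` is trivial on a whole component, and component effectiveness gives `g = 1`. No invariant metric
or linearization is needed.

Properness. Frames project continuously and equivariantly to base points, and properness lifts along
such a map by the ultrafilter criterion, once the frame bundle is known to be Hausdorff and the
prolonged action jointly continuous. The latter is Faà di Bruno's formula in charts (`coord_smul`).
-/

section Calculus

/-! ### Calculus: bounded orbits and Faà di Bruno's formula. -/

variable {A E F H : Type*} [NormedAddCommGroup A] [NormedSpace ℝ A]
  [NormedAddCommGroup E] [NormedSpace ℝ E] [NormedAddCommGroup F] [NormedSpace ℝ F]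
  [NormedAddCommGroup H] [NormedSpace ℝ H]

/-- A bounded sequence whose increments stay close to a fixed vector has zero increments. -/
theorem eq_zero_of_norm_increment_sub_le {u : ℕ → E} {w : E} {R : ℝ}
    (hu : ∀ n, ‖u (n + 1) - u n - w‖ ≤ 1 / 2 * ‖w‖) (hR : ∀ n, ‖u n - u 0‖ ≤ R) : w = 0 := by
  have key : ∀ n : ℕ, ‖u n - u 0 - (n : ℝ) • w‖ ≤ n * (1 / 2 * ‖w‖) := by
    intro n
    induction n with
    | zero => simp
    | succ n ih =>
      have : u (n + 1) - u 0 - ((n + 1 : ℕ) : ℝ) • w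
          = (u n - u 0 - (n : ℝ) • w) + (u (n + 1) - u n - w) := by
        push_cast
        module
      rw [this]
      refine (norm_add_le _ _).trans ((add_le_add ih (hu n)).trans_eq ?_)
      push_cast
      ring
  by_contra hw
  have hw' : 0 < ‖w‖ := norm_pos_iff.mpr hw
  -- The bounds combine to `n * ‖w‖ ≤ R + n * ‖w‖ / 2`, which this `n` violates.
  obtain ⟨n, hn⟩ := exists_nat_gt (R / (1 / 2 * ‖w‖))
  rw [div_lt_iff₀ (by positivity)] at hn
  have h1 : (n : ℝ) * ‖w‖ ≤ ‖u n - u 0‖ + ‖u n - u 0 - (n : ℝ) • w‖ := by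
    have := norm_sub_le (u n - u 0) (u n - u 0 - (n : ℝ) • w)
    rwa [sub_sub_cancel, norm_smul, Real.norm_natCast] at this
  have h2 := key n
  have h3 := hR n
  linarith

/-- Faà di Bruno's formula for a composition with one frozen variable. -/
theorem iteratedFDeriv_comp_prodMk_left {f : A × E → F} {a : A} {ψ : H → E} {x : H} {k : ℕ}
    (hf : ContDiffAt ℝ k f (a, ψ x)) (hψ : ContDiffAt ℝ k ψ x) :
    iteratedFDeriv ℝ k (fun v => f (a, ψ v)) x =
      ∑ c : OrderedFinpartition k, c.compAlongOrderedFinpartition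
        (iteratedFDeriv ℝ c.length f (a, ψ x)) (fun i =>
          (ContinuousLinearMap.inr ℝ A E).compContinuousMultilinearMap
            (iteratedFDeriv ℝ (c.partSize i) ψ x)) := by
  have hψ' : ContDiffAt ℝ k (fun v => (a, ψ v)) x := contDiffAt_const.prodMk hψ
  have := iteratedFDeriv_comp (f := fun v => (a, ψ v)) (g := f) hf hψ' le_rfl
  rw [Function.comp_def] at this
  rw [this]
  unfold FormalMultilinearSeries.taylorComp
  refine Finset.sum_congr rfl fun c _ => ?_
  unfold FormalMultilinearSeries.compAlongOrderedFinpartition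
  congr 1
  funext i
  have hi : ((c.partSize i : ℕ) : WithTop ℕ∞) ≤ k := by exact_mod_cast c.partSize_le i
  change iteratedFDeriv ℝ (c.partSize i) (fun v => (a, ψ v)) x = _
  -- All parts have positive size, so the frozen variable contributes only vanishing derivatives.
  rw [iteratedFDeriv_prodMk contDiffAt_const hψ hi,
    iteratedFDeriv_const_of_ne (c.partSize_pos i).ne']
  rfl

/-- The composition of Taylor coefficients is jointly continuous. -/
theorem OrderedFinpartition.continuous_compAlongOrderedFinpartition {n : ℕ}
    (c : OrderedFinpartition n) :
    Continuous fun q : (F [×c.length]→L[ℝ] H) × (∀ i, E [×c.partSize i]→L[ℝ] F) =>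
      c.compAlongOrderedFinpartition q.1 q.2 :=
  (c.compAlongOrderedFinpartitionL ℝ E F H).continuous_uncurry_of_multilinear

end Calculus

open Filter

/-- For a proper action stabilizers are compact. -/
theorem isCompact_stabilizer_of_properSMul {G X : Type*} [Group G] [TopologicalSpace G]
    [TopologicalSpace X] [MulAction G X] [ProperSMul G X] (x : X) :
    IsCompact {g : G | g • x = x} := by
  have h := (ProperSMul.isProperMap_smul_pair (G := G) (X := X)).isCompact_preimage
    (isCompact_singleton (x := (x, x)))
  convert h.image continuous_fst using 1
  ext g
  simp

/-! ### Elements with trivial differential at a fixed point. -/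

section LocalAction

variable {m d : ℕ} {G : Type*} [Group G] [TopologicalSpace G]
  [ChartedSpace (EuclideanSpace ℝ (Fin m)) G]
  {M : Type*} [TopologicalSpace M] [ChartedSpace (EuclideanSpace ℝ (Fin d)) M]
  [MulAction G M]

/-- A smooth action is smooth in charts. -/
theorem contDiffAt_smul_in_charts (hsm : ContMDiffSMul (𝓡 m) (𝓡 d) ∞ G M)
    {e : OpenPartialHomeomorph G (EuclideanSpace ℝ (Fin m))}
    (he : e ∈ IsManifold.maximalAtlas (𝓡 m) ∞ G)
    {c c' : OpenPartialHomeomorph M (EuclideanSpace ℝ (Fin d))}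
    (hc : c ∈ IsManifold.maximalAtlas (𝓡 d) ∞ M) (hc' : c' ∈ IsManifold.maximalAtlas (𝓡 d) ∞ M)
    {g : G} {x : M} (hg : g ∈ e.source) (hx : x ∈ c'.source) (hgx : g • x ∈ c.source) :
    ContDiffAt ℝ ∞ (fun q : EuclideanSpace ℝ (Fin m) × EuclideanSpace ℝ (Fin d) =>
      c (e.symm q.1 • c'.symm q.2)) (e g, c' x) := by
  rw [← contMDiffAt_iff_contDiffAt]
  have h1 : ContMDiffAt 𝓘(ℝ, EuclideanSpace ℝ (Fin m) × EuclideanSpace ℝ (Fin d)) (𝓡 m) ∞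
      (fun q : EuclideanSpace ℝ (Fin m) × EuclideanSpace ℝ (Fin d) => e.symm q.1) (e g, c' x) :=
    (contMDiffAt_symm_of_mem_maximalAtlas he (e.map_source hg)).comp
      (e g, c' x) contDiff_fst.contMDiff.contMDiffAt
  have h2 : ContMDiffAt 𝓘(ℝ, EuclideanSpace ℝ (Fin m) × EuclideanSpace ℝ (Fin d)) (𝓡 d) ∞
      (fun q : EuclideanSpace ℝ (Fin m) × EuclideanSpace ℝ (Fin d) => c'.symm q.2) (e g, c' x) :=
    (contMDiffAt_symm_of_mem_maximalAtlas hc' (c'.map_source hx)).comp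
      (e g, c' x) contDiff_snd.contMDiff.contMDiffAt
  have h3 := h1.smul h2
  refine ContMDiffAt.comp (e g, c' x) (g := c) ?_ h3
  refine contMDiffAt_of_mem_maximalAtlas hc ?_
  simpa [e.left_inv hg, c'.left_inv hx] using hgx

/-- The translation by `g` read in the chart `c`. -/
def smulInChart (c : OpenPartialHomeomorph M (EuclideanSpace ℝ (Fin d))) (g : G)
    (v : EuclideanSpace ℝ (Fin d)) : EuclideanSpace ℝ (Fin d) := c (g • c.symm v)

theorem contDiffAt_smulInChart (hsm : ContMDiffSMul (𝓡 m) (𝓡 d) ∞ G M)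
    {c : OpenPartialHomeomorph M (EuclideanSpace ℝ (Fin d))}
    (hc : c ∈ IsManifold.maximalAtlas (𝓡 d) ∞ M)
    {g : G} {x : M} (hx : x ∈ c.source) (hgx : g • x ∈ c.source) :
    ContDiffAt ℝ ∞ (smulInChart c g) (c x) := by
  rw [← contMDiffAt_iff_contDiffAt]
  have h1 := contMDiffAt_symm_of_mem_maximalAtlas hc (c.map_source hx)
  have h2 : ContMDiffAt (𝓡 d) (𝓡 d) ∞ (fun v => g • c.symm v) (c x) :=
    (ContMDiffSMul.contMDiff_const_smul (I := 𝓡 m) g).contMDiffAt.comp (c x) h1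
  refine ContMDiffAt.comp (c x) (g := c) ?_ h2
  refine contMDiffAt_of_mem_maximalAtlas hc ?_
  simpa [c.left_inv hx] using hgx

/-- The derivative of `smulInChart c g` at a point depends continuously on both. -/
theorem continuousAt_fderiv_smulInChart [IsManifold (𝓡 m) ∞ G]
    (hsm : ContMDiffSMul (𝓡 m) (𝓡 d) ∞ G M)
    {c : OpenPartialHomeomorph M (EuclideanSpace ℝ (Fin d))}
    (hc : c ∈ IsManifold.maximalAtlas (𝓡 d) ∞ M)
    {g : G} {x : M} (hx : x ∈ c.source) (hgx : g • x ∈ c.source) :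
    ContinuousAt (fun q : EuclideanSpace ℝ (Fin d) × G => fderiv ℝ (smulInChart c q.2) q.1)
      (c x, g) := by
  set e := chartAt (EuclideanSpace ℝ (Fin m)) g with he
  have hge : g ∈ e.source := mem_chart_source _ g
  have hF := contDiffAt_smul_in_charts hsm (IsManifold.chart_mem_maximalAtlas g) hc hc hge hx hgx
  set F := fun q : EuclideanSpace ℝ (Fin m) × EuclideanSpace ℝ (Fin d) =>
      c (e.symm q.1 • c.symm q.2) with hFdef
  have hcont : ContinuousAt (fun q : EuclideanSpace ℝ (Fin d) × G => (e q.2, q.1)) (c x, g) :=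
    ((e.continuousAt hge).comp (x := (c x, g)) (f := Prod.snd) continuousAt_snd).prodMk
      continuousAt_fst
  have hdF : ContinuousAt (fderiv ℝ F) (e g, c x) :=
    (hF.fderiv_right (m := 0) (by simp)).continuousAt
  have hlim : ContinuousAt (fun q : EuclideanSpace ℝ (Fin d) × G =>
      (fderiv ℝ F (e q.2, q.1)).comp (ContinuousLinearMap.inr ℝ _ _)) (c x, g) :=
    (ContinuousAt.comp (f := fun q : EuclideanSpace ℝ (Fin d) × G => (e q.2, q.1)) hdF
      hcont).clm_comp continuousAt_const
  refine hlim.congr ?_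
  have hdiff : ∀ᶠ q in 𝓝 (e g, c x), DifferentiableAt ℝ F q := by
    -- Regularity at a point spreads to a neighbourhood only at finite order; order one suffices
    -- here.
    have := (hF.of_le (m := 1) (by exact_mod_cast le_top)).eventually (by simp)
    exact this.mono fun q hq => hq.differentiableAt (by simp)
  filter_upwards [hcont.eventually hdiff, continuousAt_snd.eventually
    (e.open_source.mem_nhds hge)] with q hq hqe
  have : smulInChart c q.2 = fun v => F (e q.2, v) := by
    funext v
    simp [smulInChart, hFdef, e.left_inv hqe]
  rw [this]
  exact ((hq.hasFDerivAt.comp q.1 (hasFDerivAt_prodMk_right (e q.2) q.1)).fderiv).symm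

/-- Chain rule for powers of an element fixing a point with trivial differential. -/
theorem hasFDerivAt_smulInChart_pow {d : ℕ} {G M : Type*} [Group G] [TopologicalSpace M]
    [MulAction G M] [ContinuousConstSMul G M]
    {c : OpenPartialHomeomorph M (EuclideanSpace ℝ (Fin d))} {g : G} {x : M} (hx : x ∈ c.source) (hgx : g • x = x)
    (hd : HasFDerivAt (smulInChart c g) (ContinuousLinearMap.id ℝ _) (c x)) (n : ℕ) :
    HasFDerivAt (smulInChart c (g ^ n)) (ContinuousLinearMap.id ℝ _) (c x) := by
  induction n with
  | zero =>
    refine (hasFDerivAt_id (c x)).congr_of_eventuallyEq ?_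
    filter_upwards [c.open_target.mem_nhds (c.map_source hx)] with v hv
    simp [smulInChart, c.right_inv hv]
  | succ n ih =>
    have hval : smulInChart c g (c x) = c x := by simp [smulInChart, c.left_inv hx, hgx]
    have h := (hval.symm ▸ ih : HasFDerivAt (smulInChart c (g ^ n))
      (ContinuousLinearMap.id ℝ _) (smulInChart c g (c x))).comp (c x) hd
    refine h.congr_of_eventuallyEq ?_
    have hcs : ContinuousAt (fun v => g • c.symm v) (c x) :=
      (c.symm.continuousAt (c.map_source hx)).const_smul g
    have : ∀ᶠ v in 𝓝 (c x), g • c.symm v ∈ c.source := by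
      refine hcs.eventually (c.open_source.mem_nhds ?_)
      simpa [c.left_inv hx, hgx] using hx
    filter_upwards [this] with v hv
    simp [smulInChart, c.left_inv hv, pow_succ, mul_smul]

/-- An element of a smooth proper action which fixes a point with trivial differential acts
trivially near this point. -/
theorem eventually_smul_eq_of_hasFDerivAt_id [IsManifold (𝓡 m) ∞ G] [ProperSMul G M]
    (hsm : ContMDiffSMul (𝓡 m) (𝓡 d) ∞ G M)
    {c : OpenPartialHomeomorph M (EuclideanSpace ℝ (Fin d))}
    (hc : c ∈ IsManifold.maximalAtlas (𝓡 d) ∞ M) {g : G} {x : M} (hx : x ∈ c.source)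
    (hgx : g • x = x)
    (hd : HasFDerivAt (smulInChart c g) (ContinuousLinearMap.id ℝ _) (c x)) :
    ∀ᶠ y in 𝓝 x, g • y = y := by
  have hK := isCompact_stabilizer_of_properSMul (G := G) x
  -- Compactness of the stabilizer yields one neighbourhood valid for all its elements, in
  -- particular for all the powers of `g`.
  have hunif : ∀ᶠ v in 𝓝 (c x), ∀ k ∈ {k : G | k • x = x}, v ∈ c.target ∧
      k • c.symm v ∈ c.source ∧
      ‖fderiv ℝ (smulInChart c k) v - fderiv ℝ (smulInChart c k) (c x)‖ ≤ 1 / 2 := by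
    refine hK.eventually_forall_of_forall_eventually fun k (hk : k • x = x) => ?_
    have hkx : k • x ∈ c.source := hk.symm ▸ hx
    have hcs : ContinuousAt (fun q : EuclideanSpace ℝ (Fin d) × G => q.2 • c.symm q.1) (c x, k) :=
      continuousAt_snd.smul ((c.symm.continuousAt (c.map_source hx)).comp
        (x := (c x, k)) (f := Prod.fst) continuousAt_fst)
    have h2 : ∀ᶠ q in 𝓝 (c x, k), q.2 • c.symm q.1 ∈ c.source := by
      refine hcs.eventually (c.open_source.mem_nhds ?_)
      simpa [c.left_inv hx] using hkx
    have h1 : ∀ᶠ q in 𝓝 (c x, k), q.1 ∈ c.target :=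
      continuousAt_fst.eventually (c.open_target.mem_nhds (c.map_source hx))
    have hder := continuousAt_fderiv_smulInChart hsm hc hx hkx
    have hder0 : ContinuousAt (fun q : EuclideanSpace ℝ (Fin d) × G =>
        fderiv ℝ (smulInChart c q.2) (c x)) (c x, k) :=
      ContinuousAt.comp (f := fun q : EuclideanSpace ℝ (Fin d) × G => (c x, q.2)) (x := (c x, k))
        hder (continuousAt_const.prodMk continuousAt_snd)
    have h3 : ∀ᶠ q : EuclideanSpace ℝ (Fin d) × G in 𝓝 (c x, k),
        ‖fderiv ℝ (smulInChart c q.2) q.1 - fderiv ℝ (smulInChart c q.2) (c x)‖ < 1 / 2 :=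
      (hder.sub hder0).norm.tendsto.eventually_lt_const (by simp)
    filter_upwards [h1, h2, h3] with q hq1 hq2 hq3 using ⟨hq1, hq2, hq3.le⟩
  obtain ⟨r, hr, hball⟩ := Metric.eventually_nhds_iff_ball.mp hunif
  have hpow : ∀ n : ℕ, g ^ n • x = x := fun n => by
    induction n with
    | zero => simp
    | succ n ih => rw [pow_succ, mul_smul, hgx, ih]
  have hfix : ∀ n : ℕ, smulInChart c (g ^ n) (c x) = c x := fun n => by
    simp [smulInChart, c.left_inv hx, hpow n]
  -- Mean value inequality on a convex ball, where the derivative of each power is within `1/2` of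
  -- its value at `c x`, the identity.
  have hlip : ∀ n : ℕ, ∀ v ∈ Metric.ball (c x) r, ∀ w ∈ Metric.ball (c x) r,
      ‖smulInChart c (g ^ n) w - smulInChart c (g ^ n) v - (w - v)‖ ≤ 1 / 2 * ‖w - v‖ := by
    intro n v hv w hw
    refine (convex_ball (c x) r).norm_image_sub_le_of_norm_fderiv_le' (𝕜 := ℝ)
      (f := smulInChart c (g ^ n)) (φ := ContinuousLinearMap.id ℝ _) ?_ ?_ hv hw
    · intro z hz
      obtain ⟨h1, h2, -⟩ := hball z hz (g ^ n) (hpow n)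
      have := contDiffAt_smulInChart hsm hc (c.map_target h1) h2
      rw [c.right_inv h1] at this
      exact this.differentiableAt (by simp)
    · intro z hz
      have := (hball z hz (g ^ n) (hpow n)).2.2
      rwa [(hasFDerivAt_smulInChart_pow hx hgx hd n).fderiv] at this
  have hnear : ∀ᶠ v in 𝓝 (c x), smulInChart c g v ∈ Metric.ball (c x) r := by
    refine hd.continuousAt.eventually ?_
    have : smulInChart c g (c x) = c x := by simpa using hfix 1
    rw [this]
    exact Metric.ball_mem_nhds _ hr
  have hmain : ∀ᶠ v in 𝓝 (c x), g • c.symm v = c.symm v := by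
    filter_upwards [hnear, Metric.ball_mem_nhds _ hr] with v hgv hv
    obtain ⟨h1, h2, -⟩ := hball v hv g hgx
    have hw : smulInChart c g v - v = 0 := by
      -- The orbit may leave the ball: increments are estimated by applying `g ^ n` to the two
      -- points `v` and `g v` of the ball. Only boundedness matters for `R`, which is generous.
      refine eq_zero_of_norm_increment_sub_le (u := fun n => smulInChart c (g ^ n) v)
        (R := 1 / 2 * r + r + r) (fun n => ?_) (fun n => ?_)
      · have := hlip n v hv _ hgv
        have hs : smulInChart c (g ^ n) (smulInChart c g v) = smulInChart c (g ^ (n + 1)) v := by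
          simp [smulInChart, c.left_inv h2, pow_succ, mul_smul]
        rwa [hs] at this
      · have h3 := hlip n (c x) (Metric.mem_ball_self hr) v hv
        rw [hfix n] at h3
        have hvr : ‖v - c x‖ ≤ r := by
          simpa [dist_eq_norm] using (Metric.mem_ball.mp hv).le
        have h0 : smulInChart c (g ^ 0) v = v := by simp [smulInChart, c.right_inv h1]
        simp only [h0]
        have : smulInChart c (g ^ n) v - v
            = smulInChart c (g ^ n) v - c x - (v - c x) := by abel
        rw [this]
        linarith
    have : c (g • c.symm v) = v := sub_eq_zero.mp hw
    rw [← c.left_inv h2, this]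
  filter_upwards [(c.continuousAt hx).eventually hmain, c.open_source.mem_nhds hx] with y hy hys
  rwa [c.left_inv hys] at hy

/-- An element of a smooth proper action acting trivially near a point acts trivially on the
connected component of this point. -/
theorem smul_eq_of_mem_connectedComponent [IsManifold (𝓡 m) ∞ G] [IsManifold (𝓡 d) ∞ M] [T2Space M] [ProperSMul G M]
    (hsm : ContMDiffSMul (𝓡 m) (𝓡 d) ∞ G M) {g : G} {x : M} (hx : ∀ᶠ y in 𝓝 x, g • y = y) :
    ∀ y ∈ connectedComponent x, g • y = y := by
  have hclopen : IsClopen {x : M | ∀ᶠ y in 𝓝 x, g • y = y} := by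
    refine ⟨isClosed_of_closure_subset fun z hz => ?_, isOpen_setOfPred_eventually_nhds⟩
    have hzz : g • z = z := by
      have : z ∈ closure {y : M | g • y = y} :=
        closure_mono (fun y (hy : ∀ᶠ w in 𝓝 y, g • w = w) => hy.self_of_nhds) hz
      exact (isClosed_eq (continuous_const_smul g) continuous_id).closure_subset this
    set c := chartAt (EuclideanSpace ℝ (Fin d)) z
    have hc : c ∈ IsManifold.maximalAtlas (𝓡 d) ∞ M := IsManifold.chart_mem_maximalAtlas z
    have hzc : z ∈ c.source := mem_chart_source _ z
    have hgzc : g • z ∈ c.source := hzz.symm ▸ hzc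
    refine eventually_smul_eq_of_hasFDerivAt_id hsm hc hzc hzz ?_
    have hsmooth := contDiffAt_smulInChart hsm hc hzc hgzc
    have hcont : ContinuousAt (fun y => fderiv ℝ (smulInChart c g) (c y)) z :=
      ContinuousAt.comp (hsmooth.fderiv_right (m := 0) (by simp)).continuousAt (c.continuousAt hzc)
    -- The differential is the identity at points of the set arbitrarily close to `z`, hence at `z`
    -- by continuity; the local result then puts `z` in the set.
    have hfd : fderiv ℝ (smulInChart c g) (c z) = ContinuousLinearMap.id ℝ _ := by
      have hfreq : ∃ᶠ y in 𝓝 z,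
          fderiv ℝ (smulInChart c g) (c y) = ContinuousLinearMap.id ℝ _ := by
        refine ((mem_closure_iff_frequently.mp hz).and_eventually
          (c.open_source.mem_nhds hzc)).mono ?_
        rintro y ⟨hy : ∀ᶠ w in 𝓝 y, g • w = w, hyc⟩
        have : smulInChart c g =ᶠ[𝓝 (c y)] id := by
          have h1 : ∀ᶠ v in 𝓝 (c y), g • c.symm v = c.symm v := by
            refine (c.symm.continuousAt (c.map_source hyc)).eventually
              (p := fun w => g • w = w) ?_
            simpa [c.left_inv hyc] using hy
          filter_upwards [h1, c.open_target.mem_nhds (c.map_source hyc)] with v hv hvt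
          simp [smulInChart, hv, c.right_inv hvt]
        rw [this.fderiv_eq, fderiv_id]
      by_contra hne
      exact hfreq (hcont.eventually_ne hne)
    rw [← hfd]
    exact (hsmooth.differentiableAt (by simp)).hasFDerivAt
  intro y hy
  exact Eventually.self_of_nhds (p := fun w => g • w = w)
    (hclopen.connectedComponent_subset hx hy)

end LocalAction

namespace FrameBundle

/-! ### Coordinates and topology of the frame bundle. -/

section Coordinates

variable {d ℓ : ℕ} {M : Type*} [TopologicalSpace M]
  [ChartedSpace (EuclideanSpace ℝ (Fin d)) M]

/-- The base point of a frame. -/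
noncomputable def base (u : FrameBundle d ℓ M) : M :=
  Quotient.lift (fun φ : LocalParam d M => φ.1 0) (fun _ _ h => And.left h) u

/-- The coordinates of a frame in a chart around its base point. -/
noncomputable def coord (c : OpenPartialHomeomorph M (EuclideanSpace ℝ (Fin d)))
    (u : FrameBundle d ℓ M) : JetSpace d ℓ :=
  jetInChart ℓ c (Quotient.out u).1

theorem exists_rep (u : FrameBundle d ℓ M) : ∃ φ : LocalParam d M, mk ℓ φ = u :=
  Quotient.exists_rep u

theorem mk_eq_mk_iff {φ ψ : LocalParam d M} :
    mk ℓ φ = mk ℓ ψ ↔ φ.1 0 = ψ.1 0 ∧ ∀ c ∈ IsManifold.maximalAtlas (𝓡 d) ∞ M,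
      φ.1 0 ∈ c.source → jetInChart ℓ c φ.1 = jetInChart ℓ c ψ.1 :=
  Quotient.eq (r := jetSetoid d ℓ M)

variable {c : OpenPartialHomeomorph M (EuclideanSpace ℝ (Fin d))}

/-- The representative chosen by `Quotient.out` is harmless over the domain of `c`, since equivalent
parametrizations have equal jets there. -/
theorem coord_mk (hc : c ∈ IsManifold.maximalAtlas (𝓡 d) ∞ M) {φ : LocalParam d M}
    (hφ : φ.1 0 ∈ c.source) : coord c (mk ℓ φ) = jetInChart ℓ c φ.1 := by
  have h : mk ℓ φ = mk ℓ (Quotient.out (mk ℓ φ)) := (Quotient.out_eq (mk ℓ φ)).symm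
  exact ((mk_eq_mk_iff.mp h).2 c hc hφ).symm

theorem mem_box_iff (hc : c ∈ IsManifold.maximalAtlas (𝓡 d) ∞ M) {V : Set (JetSpace d ℓ)}
    {u : FrameBundle d ℓ M} : u ∈ box ℓ c V ↔ base u ∈ c.source ∧ coord c u ∈ V := by
  constructor
  · rintro ⟨φ, rfl, h1, h2⟩
    exact ⟨h1, (coord_mk hc h1).symm ▸ h2⟩
  · rintro ⟨h1, h2⟩
    obtain ⟨φ, rfl⟩ := exists_rep u
    exact ⟨φ, rfl, h1, coord_mk hc h1 ▸ h2⟩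

theorem isOpen_box (hc : c ∈ IsManifold.maximalAtlas (𝓡 d) ∞ M) {V : Set (JetSpace d ℓ)}
    (hV : IsOpen V) : IsOpen (box (M := M) ℓ c V) :=
  TopologicalSpace.isOpen_generateFrom_of_mem ⟨c, hc, V, hV, rfl⟩

theorem continuousAt_coord (hc : c ∈ IsManifold.maximalAtlas (𝓡 d) ∞ M) {u : FrameBundle d ℓ M}
    (hu : base u ∈ c.source) : ContinuousAt (coord c : FrameBundle d ℓ M → JetSpace d ℓ) u := by
  refine tendsto_nhds.mpr fun V hV hm => ?_
  filter_upwards [(isOpen_box hc hV).mem_nhds ((mem_box_iff hc).mpr ⟨hu, hm⟩)] with w hw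
  exact ((mem_box_iff hc).mp hw).2

theorem eventually_base_mem_source (hc : c ∈ IsManifold.maximalAtlas (𝓡 d) ∞ M)
    {u : FrameBundle d ℓ M} (hu : base u ∈ c.source) : ∀ᶠ w in 𝓝 u, base w ∈ c.source := by
  filter_upwards [(isOpen_box hc isOpen_univ).mem_nhds
    ((mem_box_iff hc).mpr ⟨hu, Set.mem_univ _⟩)] with w hw
  exact ((mem_box_iff hc).mp hw).1

theorem coord_zero_apply (hc : c ∈ IsManifold.maximalAtlas (𝓡 d) ∞ M) {u : FrameBundle d ℓ M}
    (hu : base u ∈ c.source) (v : Fin 0 → EuclideanSpace ℝ (Fin d)) :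
    coord c u 0 v = c (base u) := by
  obtain ⟨φ, rfl⟩ := exists_rep u
  rw [coord_mk hc hu]
  rfl

theorem contDiffAt_chart_comp (hc : c ∈ IsManifold.maximalAtlas (𝓡 d) ∞ M) (φ : LocalParam d M)
    (hφ : φ.1 0 ∈ c.source) : ContDiffAt ℝ ∞ (fun v => c (φ.1 v)) 0 := by
  rw [← contMDiffAt_iff_contDiffAt]
  exact (contMDiffAt_of_mem_maximalAtlas hc hφ).comp 0 φ.2.contMDiffAt

/-- Chain rule for the germ of a local inverse. Surjectivity is what allows the differential of `φ`
to be cancelled on the right. -/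
theorem surjective_fderiv_chart_comp (hc : c ∈ IsManifold.maximalAtlas (𝓡 d) ∞ M)
    (φ : LocalParam d M) (hφ : φ.1 0 ∈ c.source) :
    Function.Surjective (fderiv ℝ (fun v => c (φ.1 v)) 0) := by
  set θ := φ.2.localInverse
  have hθ0 : θ (c.symm (c (φ.1 0))) = 0 := by
    rw [c.left_inv hφ]
    exact φ.2.localInverse_left_inv φ.2.localInverse_mem_target
  have hθ : DifferentiableAt ℝ (fun v => θ (c.symm v)) (c (φ.1 0)) := by
    refine ContDiffAt.differentiableAt (n := ∞) ?_ (by simp)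
    rw [← contMDiffAt_iff_contDiffAt]
    refine ContMDiffAt.comp (c (φ.1 0)) (g := θ) ?_
      (contMDiffAt_symm_of_mem_maximalAtlas hc (c.map_source hφ))
    rw [c.left_inv hφ]
    exact φ.2.localInverse_contMDiffAt
  have hψ : DifferentiableAt ℝ (fun v => c (φ.1 v)) (θ (c.symm (c (φ.1 0)))) := by
    rw [hθ0]
    exact (contDiffAt_chart_comp hc φ hφ).differentiableAt (by simp)
  have hinv : (fun v => c (φ.1 v)) ∘ (fun v => θ (c.symm v)) =ᶠ[𝓝 (c (φ.1 0))] id := by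
    have h : ∀ᶠ y in 𝓝 (c.symm (c (φ.1 0))), φ.1 (θ y) = y := by
      rw [c.left_inv hφ]
      exact φ.2.localInverse_eventuallyEq_right
    filter_upwards [(c.symm.continuousAt (c.map_source hφ)).eventually h,
      c.open_target.mem_nhds (c.map_source hφ)] with v hv hvt
    simp [hv, c.right_inv hvt]
  have hcomp := fderiv_comp (c (φ.1 0)) hψ hθ
  rw [hinv.fderiv_eq, fderiv_id, hθ0] at hcomp
  intro w
  exact ⟨fderiv ℝ (fun v => θ (c.symm v)) (c (φ.1 0)) w, (congrArg (fun T => T w) hcomp).symm⟩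

/-- Frames with the same base point and the same coordinates in one chart are equal. -/
theorem eq_of_coord_eq (hc : c ∈ IsManifold.maximalAtlas (𝓡 d) ∞ M) {u w : FrameBundle d ℓ M}
    (hb : base u = base w) (hu : base u ∈ c.source) (h : coord c u = coord c w) : u = w := by
  obtain ⟨φ, rfl⟩ := exists_rep u
  obtain ⟨ψ, rfl⟩ := exists_rep w
  have hb' : φ.1 0 = ψ.1 0 := hb
  have hφ : φ.1 0 ∈ c.source := hu
  have hψ : ψ.1 0 ∈ c.source := hb' ▸ hφ
  rw [coord_mk hc hφ, coord_mk hc hψ] at h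
  refine mk_eq_mk_iff.mpr ⟨hb', fun c' hc' hφ' => ?_⟩
  -- The jet in `c'` is obtained from the jet in `c` by Faà di Bruno's formula for the transition
  -- map, using only orders up to `k ≤ ℓ`.
  have htrans : ContDiffAt ℝ ∞ (fun v => c' (c.symm v)) (c (φ.1 0)) := by
    rw [← contMDiffAt_iff_contDiffAt]
    refine ContMDiffAt.comp (c (φ.1 0)) (g := c') (contMDiffAt_of_mem_maximalAtlas hc' ?_)
      (contMDiffAt_symm_of_mem_maximalAtlas hc (c.map_source hφ))
    rwa [c.left_inv hφ]
  have hjet : ∀ χ : LocalParam d M, χ.1 0 ∈ c.source →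
      (fun v => c' (χ.1 v)) =ᶠ[𝓝 0] (fun v => c' (c.symm v)) ∘ (fun v => c (χ.1 v)) := by
    intro χ hχ
    filter_upwards [χ.2.contMDiffAt.continuousAt.eventually (c.open_source.mem_nhds hχ)] with v hv
    simp [c.left_inv hv]
  funext k
  have hle : ((k : ℕ) : WithTop ℕ∞) ≤ ∞ := by exact_mod_cast le_top
  change iteratedFDeriv ℝ (k : ℕ) (fun v => c' (φ.1 v)) 0 =
    iteratedFDeriv ℝ (k : ℕ) (fun v => c' (ψ.1 v)) 0
  rw [((hjet φ hφ).iteratedFDeriv ℝ k).eq_of_nhds, ((hjet ψ hψ).iteratedFDeriv ℝ k).eq_of_nhds,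
    iteratedFDeriv_comp (f := fun v => c (φ.1 v)) htrans (contDiffAt_chart_comp hc φ hφ) hle,
    iteratedFDeriv_comp (f := fun v => c (ψ.1 v)) (hb' ▸ htrans) (contDiffAt_chart_comp hc ψ hψ) hle, hb']
  unfold FormalMultilinearSeries.taylorComp
  refine Finset.sum_congr rfl fun p _ => ?_
  unfold FormalMultilinearSeries.compAlongOrderedFinpartition
  congr 1
  funext i
  exact congrFun h ⟨p.partSize i, (p.partSize_le i).trans_lt k.2⟩

variable [IsManifold (𝓡 d) ∞ M]

/-- Locally the base point is `c.symm` of the order-zero coefficient, which is continuous. -/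
theorem continuous_base : Continuous (base : FrameBundle d ℓ M → M) := by
  refine continuous_iff_continuousAt.mpr fun u => ?_
  set c := chartAt (EuclideanSpace ℝ (Fin d)) (base u)
  have hc : c ∈ IsManifold.maximalAtlas (𝓡 d) ∞ M := IsManifold.chart_mem_maximalAtlas _
  have hu : base u ∈ c.source := mem_chart_source _ _
  have h0 : ContinuousAt (fun w : FrameBundle d ℓ M =>
      coord c w 0 (0 : Fin 0 → EuclideanSpace ℝ (Fin d))) u :=
    (ContinuousMultilinearMap.apply ℝ (fun _ : Fin 0 => EuclideanSpace ℝ (Fin d))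
      (EuclideanSpace ℝ (Fin d)) 0).continuous.continuousAt.comp
      ((continuous_apply (0 : Fin (ℓ + 1))).continuousAt.comp (continuousAt_coord hc hu))
  have h1 : ContinuousAt (fun w : FrameBundle d ℓ M =>
      c.symm (coord c w 0 (0 : Fin 0 → EuclideanSpace ℝ (Fin d)))) u := by
    refine ContinuousAt.comp (g := c.symm) (c.symm.continuousAt ?_) h0
    rw [coord_zero_apply hc hu]
    exact c.map_source hu
  refine h1.congr ?_
  filter_upwards [eventually_base_mem_source hc hu] with w hw
  rw [coord_zero_apply hc hw, c.left_inv hw]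

/-- If every neighbourhood of `u` meets every neighbourhood of `w`, uniqueness of limits in `M`
identifies the base points, and then uniqueness in `JetSpace d ℓ` identifies the coordinates. -/
instance instT2Space [T2Space M] : T2Space (FrameBundle d ℓ M) := by
  refine t2_iff_nhds.mpr fun {u w} huw => ?_
  have hb : base u = base w :=
    tendsto_nhds_unique ((continuous_base.tendsto u).mono_left inf_le_left)
      ((continuous_base.tendsto w).mono_left inf_le_right)
  set c := chartAt (EuclideanSpace ℝ (Fin d)) (base u)
  have hc : c ∈ IsManifold.maximalAtlas (𝓡 d) ∞ M := IsManifold.chart_mem_maximalAtlas _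
  have hu : base u ∈ c.source := mem_chart_source _ _
  refine eq_of_coord_eq hc hb hu ?_
  exact tendsto_nhds_unique ((continuousAt_coord hc hu).mono_left inf_le_left)
    ((continuousAt_coord hc (hb ▸ hu)).mono_left inf_le_right)

end Coordinates

/-! ### The prolonged action: continuity, properness, freeness. -/

section Action

variable {m d ℓ : ℕ} {G : Type*} [Group G] [TopologicalSpace G]
  [ChartedSpace (EuclideanSpace ℝ (Fin m)) G]
  {M : Type*} [TopologicalSpace M] [ChartedSpace (EuclideanSpace ℝ (Fin d)) M]
  [IsManifold (𝓡 d) ∞ M] [MulAction G M]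

theorem smul_mk (hsm : ContMDiffSMul (𝓡 m) (𝓡 d) ∞ G M) (g : G) (φ : LocalParam d M) :
    letI := prolongedAction (M := M) ℓ hsm
    g • mk ℓ φ = mk ℓ (φ.translate hsm g) := rfl

theorem base_smul (hsm : ContMDiffSMul (𝓡 m) (𝓡 d) ∞ G M) (g : G) (u : FrameBundle d ℓ M) :
    letI := prolongedAction (M := M) ℓ hsm
    base (g • u) = g • base u := by
  obtain ⟨φ, rfl⟩ := exists_rep u
  rfl

/-- The coordinates of the prolonged action, by Faà di Bruno's formula. -/
theorem coord_smul (hsm : ContMDiffSMul (𝓡 m) (𝓡 d) ∞ G M)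
    {e : OpenPartialHomeomorph G (EuclideanSpace ℝ (Fin m))}
    (he : e ∈ IsManifold.maximalAtlas (𝓡 m) ∞ G)
    {c c' : OpenPartialHomeomorph M (EuclideanSpace ℝ (Fin d))}
    (hc : c ∈ IsManifold.maximalAtlas (𝓡 d) ∞ M) (hc' : c' ∈ IsManifold.maximalAtlas (𝓡 d) ∞ M)
    {g : G} {u : FrameBundle d ℓ M} (hg : g ∈ e.source) (hu : base u ∈ c'.source)
    (hgu : g • base u ∈ c.source) (k : Fin (ℓ + 1)) :
    letI := prolongedAction (M := M) ℓ hsm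
    coord c (g • u) k = ∑ p : OrderedFinpartition (k : ℕ), p.compAlongOrderedFinpartition
      (iteratedFDeriv ℝ p.length (fun q : EuclideanSpace ℝ (Fin m) × EuclideanSpace ℝ (Fin d) =>
        c (e.symm q.1 • c'.symm q.2)) (e g, c' (base u)))
      (fun i => (ContinuousLinearMap.inr ℝ _ _).compContinuousMultilinearMap
        (coord c' u ⟨p.partSize i, (p.partSize_le i).trans_lt k.2⟩)) := by
  let := prolongedAction (M := M) ℓ hsm
  obtain ⟨φ, rfl⟩ := exists_rep u
  have hle : ((k : ℕ) : WithTop ℕ∞) ≤ ∞ := by exact_mod_cast le_top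
  rw [smul_mk, coord_mk hc (φ := φ.translate hsm g) hgu, coord_mk hc' hu]
  have hF := (contDiffAt_smul_in_charts hsm he hc hc' hg hu hgu).of_le hle
  refine Eq.trans ?_ (iteratedFDeriv_comp_prodMk_left (ψ := fun v => c' (φ.1 v)) hF
    ((contDiffAt_chart_comp hc' φ hu).of_le hle))
  refine (EventuallyEq.iteratedFDeriv ℝ ?_ k).eq_of_nhds
  filter_upwards [φ.2.contMDiffAt.continuousAt.eventually (c'.open_source.mem_nhds hu)] with v hv
  simp [LocalParam.translate, e.left_inv hg, c'.left_inv hv]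

/-- The prolonged action is jointly continuous. -/
theorem continuousSMul_prolongedAction [IsManifold (𝓡 m) ∞ G] (hsm : ContMDiffSMul (𝓡 m) (𝓡 d) ∞ G M) :
    letI := prolongedAction (M := M) ℓ hsm
    ContinuousSMul G (FrameBundle d ℓ M) := by
  let := prolongedAction (M := M) ℓ hsm
  have : ContinuousSMul G M := ContMDiffSMul.continuousSMul (I := 𝓡 m) (I' := 𝓡 d) ∞
  refine ⟨continuous_iff_continuousAt.mpr ?_⟩
  rintro ⟨g, u⟩
  -- It suffices to test the generating boxes, that is, continuity of the base point and of the
  -- coordinates.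
  refine TopologicalSpace.tendsto_nhds_generateFrom_iff.mpr ?_
  rintro _ ⟨c, hc, V, hV, rfl⟩ hgu
  obtain ⟨h1, h2⟩ := (mem_box_iff hc).mp hgu
  replace h1 : g • base u ∈ c.source := base_smul hsm g u ▸ h1
  set e := chartAt (EuclideanSpace ℝ (Fin m)) g
  have he : e ∈ IsManifold.maximalAtlas (𝓡 m) ∞ G := IsManifold.chart_mem_maximalAtlas g
  have hg : g ∈ e.source := mem_chart_source _ _
  set c' := chartAt (EuclideanSpace ℝ (Fin d)) (base u)
  have hc' : c' ∈ IsManifold.maximalAtlas (𝓡 d) ∞ M := IsManifold.chart_mem_maximalAtlas _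
  have hu : base u ∈ c'.source := mem_chart_source _ _
  have hbase : ContinuousAt (fun q : G × FrameBundle d ℓ M => base q.2) (g, u) :=
    (continuous_base.comp continuous_snd).continuousAt
  have hev1 : ∀ᶠ q : G × FrameBundle d ℓ M in 𝓝 (g, u), q.1 ∈ e.source :=
    continuousAt_fst.eventually (e.open_source.mem_nhds hg)
  have hev2 : ∀ᶠ q : G × FrameBundle d ℓ M in 𝓝 (g, u), base q.2 ∈ c'.source :=
    hbase.eventually (c'.open_source.mem_nhds hu)
  have hev3 : ∀ᶠ q : G × FrameBundle d ℓ M in 𝓝 (g, u), q.1 • base q.2 ∈ c.source :=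
    (continuousAt_fst.smul hbase).eventually (c.open_source.mem_nhds h1)
  have hcoord : ContinuousAt (fun q : G × FrameBundle d ℓ M => coord c' q.2) (g, u) :=
    ContinuousAt.comp (f := Prod.snd) (x := (g, u)) (continuousAt_coord hc' hu) continuousAt_snd
  have hpt : ContinuousAt (fun q : G × FrameBundle d ℓ M => (e q.1, c' (base q.2))) (g, u) :=
    (ContinuousAt.comp (f := Prod.fst) (x := (g, u)) (e.continuousAt hg) continuousAt_fst).prodMk
      (ContinuousAt.comp (f := fun q : G × FrameBundle d ℓ M => base q.2) (x := (g, u))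
        (c'.continuousAt hu) hbase)
  have hF := contDiffAt_smul_in_charts hsm he hc hc' hg hu h1
  have hcont : ContinuousAt (fun q : G × FrameBundle d ℓ M => coord c (q.1 • q.2)) (g, u) := by
    refine continuousAt_pi.mpr fun k => ?_
    -- Each Faà di Bruno term is continuous in the derivatives of the action map and in the
    -- coordinates of the frame.
    have hsum := tendsto_finsetSum (Finset.univ : Finset (OrderedFinpartition (k : ℕ)))
      (fun p _ => (p.continuous_compAlongOrderedFinpartition.continuousAt.comp
        (f := fun q : G × FrameBundle d ℓ M => (iteratedFDeriv ℝ p.length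
          (fun q : EuclideanSpace ℝ (Fin m) × EuclideanSpace ℝ (Fin d) =>
            c (e.symm q.1 • c'.symm q.2)) (e q.1, c' (base q.2)),
          fun i => (ContinuousLinearMap.inr ℝ (EuclideanSpace ℝ (Fin m))
            (EuclideanSpace ℝ (Fin d))).compContinuousMultilinearMap
            (coord c' q.2 ⟨p.partSize i, (p.partSize_le i).trans_lt k.2⟩)))
        (x := (g, u)) (by
          refine ContinuousAt.prodMk ?_ (continuousAt_pi.mpr fun i => ?_)
          · exact ContinuousAt.comp (x := (g, u)) (hF.continuousAt_iteratedFDeriv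
              (by exact_mod_cast le_top)) hpt
          · exact ContinuousAt.comp (x := (g, u)) (ContinuousLinearMap.compContinuousMultilinearMapL
              ℝ _ _ _ (ContinuousLinearMap.inr ℝ (EuclideanSpace ℝ (Fin m))
              (EuclideanSpace ℝ (Fin d)))).continuous.continuousAt
              (continuousAt_pi.mp hcoord _))).tendsto)
    refine ContinuousAt.congr hsum ?_
    filter_upwards [hev1, hev2, hev3] with q hq1 hq2 hq3
    exact (coord_smul hsm he hc hc' hq1 hq2 hq3 k).symm
  filter_upwards [hev3, hcont.eventually (hV.mem_nhds h2)] with q hq1 hq2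
  exact (mem_box_iff hc).mpr ⟨(base_smul hsm q.1 q.2).symm ▸ hq1, hq2⟩

/-- Properness passes to the frame bundle along the equivariant projection to the base. -/
theorem properSMul_prolongedAction [IsManifold (𝓡 m) ∞ G] [T2Space M] [ProperSMul G M]
    (hsm : ContMDiffSMul (𝓡 m) (𝓡 d) ∞ G M) :
    letI := prolongedAction (M := M) ℓ hsm
    ProperSMul G (FrameBundle d ℓ M) := by
  let := prolongedAction (M := M) ℓ hsm
  refine properSMul_iff_continuousSMul_ultrafilter_tendsto_t2.mpr
    ⟨continuousSMul_prolongedAction hsm, fun 𝒰 u w h => ?_⟩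
  have hb : Tendsto (fun q : G × M => (q.1 • q.2, q.2))
      (𝒰.map fun q : G × FrameBundle d ℓ M => (q.1, base q.2)) (𝓝 (base u, base w)) := by
    have := ((continuous_base.prodMap continuous_base).tendsto (u, w)).comp h
    rw [Ultrafilter.coe_map, tendsto_map'_iff]
    refine this.congr fun q => ?_
    simp [base_smul]
  obtain ⟨g, hg⟩ := (properSMul_iff_continuousSMul_ultrafilter_tendsto_t2.mp
    (inferInstance : ProperSMul G M)).2 _ _ _ hb
  -- The pushforward of `𝒰` has the same `G`-component, so the limit found downstairs serves
  -- upstairs.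
  exact ⟨g, hg⟩

/-- A component effective proper action is free on frames. -/
theorem freeAction_prolongedAction [IsManifold (𝓡 m) ∞ G] [T2Space M] [ProperSMul G M]
    (hsm : ContMDiffSMul (𝓡 m) (𝓡 d) ∞ G M) (heff : ComponentEffective G M) (hℓ : 1 ≤ ℓ) :
    letI := prolongedAction (M := M) ℓ hsm
    FreeAction G (FrameBundle d ℓ M) := by
  let := prolongedAction (M := M) ℓ hsm
  intro u
  refine (Subgroup.eq_bot_iff_forall _).mpr fun g hg => ?_
  by_contra hne
  replace hg : g • u = u := hg
  have hbase : g • base u = base u := by rw [← base_smul hsm, hg]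
  obtain ⟨y, hy, hgy⟩ := heff g hne (base u)
  refine hgy (smul_eq_of_mem_connectedComponent hsm ?_ y hy)
  obtain ⟨φ, rfl⟩ := exists_rep u
  set c := chartAt (EuclideanSpace ℝ (Fin d)) (φ.1 0)
  have hc : c ∈ IsManifold.maximalAtlas (𝓡 d) ∞ M := IsManifold.chart_mem_maximalAtlas _
  have hx : φ.1 0 ∈ c.source := mem_chart_source _ _
  replace hbase : g • φ.1 0 = φ.1 0 := hbase
  have hgx : g • φ.1 0 ∈ c.source := hbase.symm ▸ hx
  refine eventually_smul_eq_of_hasFDerivAt_id hsm hc hx hbase ?_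
  have hd := (contDiffAt_smulInChart hsm hc hx hgx).differentiableAt (by simp)
  have hψ := (contDiffAt_chart_comp hc φ hx).differentiableAt (by simp)
  have hjet := (mk_eq_mk_iff.mp hg).2 c hc hgx
  have hder : (fderiv ℝ (smulInChart c g) (c (φ.1 0))).comp (fderiv ℝ (fun v => c (φ.1 v)) 0) =
      fderiv ℝ (fun v => c (φ.1 v)) 0 := by
    rw [← fderiv_comp 0 hd hψ]
    have h1 : smulInChart c g ∘ (fun v => c (φ.1 v)) =ᶠ[𝓝 0] fun v => c (g • φ.1 v) := by
      filter_upwards [φ.2.contMDiffAt.continuousAt.eventually (c.open_source.mem_nhds hx)] with v hv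
      simp [smulInChart, c.left_inv hv]
    rw [h1.fderiv_eq]
    ext1 v
    -- The order-one coefficient is part of the jet because `1 ≤ ℓ`.
    have := congrArg (fun T => T (fun _ => v)) (congrFun hjet ⟨1, by omega⟩)
    simpa [jetInChart, iteratedFDeriv_one_apply, LocalParam.translate] using this
  have hid : fderiv ℝ (smulInChart c g) (c (φ.1 0)) = ContinuousLinearMap.id ℝ _ := by
    ext1 w
    obtain ⟨v, rfl⟩ := surjective_fderiv_chart_comp hc φ hx w
    exact congrArg (fun T => T v) hder
  rw [← hid]
  exact hd.hasFDerivAt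

end Action

end FrameBundle

theorem mainTheorem6 {m d : ℕ}
    {G : Type*} [Group G] [TopologicalSpace G] [T2Space G]
    [ChartedSpace (EuclideanSpace ℝ (Fin m)) G] [LieGroup (𝓡 m) ∞ G]
    {M : Type*} [TopologicalSpace M] [T2Space M]
    [ChartedSpace (EuclideanSpace ℝ (Fin d)) M] [IsManifold (𝓡 d) ∞ M]
    [MulAction G M] (hsmooth : ContMDiffSMul (𝓡 m) (𝓡 d) ∞ G M)
    (hproper : ProperSMul G M) (heff : ComponentEffective G M)
    (ℓ : ℕ) (hℓ : 1 ≤ ℓ) :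
    letI : MulAction G (FrameBundle d ℓ M) := prolongedAction ℓ hsmooth
    ProperSMul G (FrameBundle d ℓ M) ∧ FreeAction G (FrameBundle d ℓ M) := by
  exact ⟨FrameBundle.properSMul_prolongedAction hsmooth,
    FrameBundle.freeAction_prolongedAction hsmooth heff hℓ⟩
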